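/- Let $R$ be a finite chain ring, i.e. a finite commutative ring with $1\neq 0$ whose ideals are totally ordered by inclusion. Let $\gamma$ be a generator of its maximal ideal, assume that the nilpotency index $e$ of $\gamma$ is even, and let the residue field $R/\langle\gamma\rangle$ have $p^r$ elements, $p$ prime. Let $n$ be a positive integer with $\gcd(n,p)=1$. A cyclic code of length $n$ over $R$ is an $R$-submodule $C\subseteq R^n$ such that $(c_{n-1},c_0,\dots,c_{n-2})\in C$ whenever $(c_0,\dots,c_{n-1})\in C$; it is self-dual if $C=C^\perp$ for the inner product $\sum_i u_iv_i$, and it is called non-trivial if it differs from the trivial self-dual code $\gamma^{e/2}R^n$ (the code with generator matrix $\gamma^{e/2}I_n$). Then there exists a non-trivial cyclic self-dual code of length $n$ over $R$ if and only if $$(p^r)^i\not\equiv -1 \pmod n\quad\text{for every positive integer } i.$$ Moreover, this condition holds if and only if the $p^r$-cyclotomic coset $C_1$ modulo $n$ is not reversible, i.e. $C_1\neq C_{-1}$, where $C_u=\{u\,(p^r)^j \bmod n : j\ge 0\}$. -/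

import Mathlib

/-- A finite chain ring: a finite commutative ring with `1 ≠ 0` whose ideals are ordered by
inclusion. -/
structure IsFiniteChainRing (R : Type*) [CommRing R] : Prop where
  finite : Finite R
  nontrivial : Nontrivial R
  ideal_total : ∀ I J : Ideal R, I ≤ J ∨ J ≤ I

namespace LinearCode

/-- The dual of a linear code with respect to the standard inner product `∑ uᵢ vᵢ`. -/
def dual {R : Type*} [CommRing R] {n : ℕ} (C : Submodule R (Fin n → R)) :
    Submodule R (Fin n → R) where
  carrier := {u | ∀ v ∈ C, ∑ i, u i * v i = 0}
  zero_mem' := by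
    intro v _
    simp
  add_mem' := by
    intro a b ha hb v hv
    simp [add_mul, Finset.sum_add_distrib, ha v hv, hb v hv]
  smul_mem' := by
    intro c a ha v hv
    simp [mul_assoc, ← Finset.mul_sum, ha v hv]

/-- `C` equals its dual. -/
def IsSelfDual {R : Type*} [CommRing R] {n : ℕ} (C : Submodule R (Fin n → R)) : Prop :=
  C = dual C

/-- `C` is closed under `(c₀, …, cₙ₋₁) ↦ (cₙ₋₁, c₀, …, cₙ₋₂)`; the permutation `finRotate n`
sends `i` to `i + 1` modulo `n`. -/
def IsCyclic {R : Type*} [CommRing R] {n : ℕ} (C : Submodule R (Fin n → R)) : Prop :=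
  ∀ c ∈ C, (fun i => c ((finRotate n).symm i)) ∈ C

/-- For a generator `γ` of the maximal ideal with even nilpotency index `e`, the trivial self-dual
code of length `n`: its generator matrix is `γ ^ (e / 2) Iₙ`, that is, it is spanned by the rows of
this matrix. -/
def trivialCode {R : Type*} [CommRing R] (γ : R) (e n : ℕ) : Submodule R (Fin n → R) :=
  Submodule.span R (Set.range (γ ^ (e / 2) • (1 : Matrix (Fin n) (Fin n) R)).row)

end LinearCode

/-- The `q`-cyclotomic coset `{u, u q, u q², …}` of `u` modulo `n`. -/
def cyclotomicCoset (q n : ℕ) (u : ZMod n) : Set (ZMod n) :=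
  {x | ∃ i : ℕ, x = u * (q : ZMod n) ^ i}

/-- The coset of `u` is reversible if it is also the coset of `-u`. -/
def IsReversibleCoset (q n : ℕ) (u : ZMod n) : Prop :=
  cyclotomicCoset q n u = cyclotomicCoset q n (-u)

/-!
Write `q = p ^ r`, let `e` be the nilpotency index of `γ`, let `K = R / ⟨γ⟩`, and identify words of
length `n` with elements of the group algebra `R[ℤ/n]`. Cyclic codes are then the ideals. With
`σ = groupInv` the involution inverting the group elements, the inner product of `a` and `b` is the
constant coefficient of `a * σ b`, so `a` lies in the dual of a cyclic code `C` exactly when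
`a * σ b = 0` for all `b ∈ C` (`LinearCode.IsCyclic.mem_dual_iff`).

If `q ^ i ≡ -1` modulo `n`, then `σ` is the `q ^ i`-power map on `K[ℤ/n]`. There `a * σ a = 0` makes
`a` nilpotent, hence zero, since `a` is also a power of itself
(`eq_zero_of_mul_groupInv_eq_zero`). A word `γ ^ j b` of a self-dual cyclic code satisfies
`γ ^ (2 * j) (b * σ b) = 0`; as long as `2 * j < e` this gives `b * σ b = 0` over `K`, so `b` is
divisible by `γ`. The code is thus contained in the trivial one, and by duality equal to it
(`IsFiniteChainRing.selfDual_eq_trivialCode`).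

If no power of `q` is `-1` modulo `n`, a primitive `n`-th root of unity `ζ` over `K` is not
conjugate to `ζ⁻¹`, so the kernel `𝔪` of evaluation at `ζ` and its image `σ 𝔪` are distinct maximal
ideals. Every ideal of `K[ℤ/n]` is generated by an idempotent, and `𝔪 = (1 - ε)` gives `ε ≠ 0` with
`ε * σ ε = 0` (`exists_idempotent_mul_groupInv_eq_zero`). It lifts to an idempotent `E` over `R`
with `E * σ E = 0` (`exists_idempotent_lift`), and the ideal generated by
`γ ^ (e / 2 - 1) E`, `γ ^ (e / 2 + 1) (σ E)` and `γ ^ (e / 2) (1 - E - σ E)` is a nontrivial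
self-dual code (`IsFiniteChainRing.exists_selfDual_ne_trivialCode`).
-/

open AddMonoidAlgebra

/-! ### The involution of a group algebra -/

section GroupAlgebra

variable {R K G : Type*} [CommRing R] [Field K] [AddCommGroup G]

/-- The involution of the group algebra `R[G]` that inverts the group elements. -/
noncomputable def groupInv (R G : Type*) [CommRing R] [AddCommGroup G] :
    AddMonoidAlgebra R G →+* AddMonoidAlgebra R G :=
  mapDomainRingHom R (negAddMonoidHom : G →+ G)

@[simp] lemma groupInv_single (g : G) (r : R) :
    groupInv R G (single g r) = single (-g) r := by
  simp [groupInv]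

@[simp] lemma groupInv_groupInv (a : AddMonoidAlgebra R G) :
    groupInv R G (groupInv R G a) = a := by
  induction a using AddMonoidAlgebra.induction_linear with
  | zero => simp
  | add x y hx hy => simp [hx, hy]
  | single m r => simp

@[simp] lemma coeff_groupInv (a : AddMonoidAlgebra R G) (g : G) :
    (groupInv R G a).coeff g = a.coeff (-g) := by
  classical
  induction a using AddMonoidAlgebra.induction_linear with
  | zero => simp
  | add x y hx hy => simp [hx, hy]
  | single m r => simp [Finsupp.single_apply, neg_eq_iff_eq_neg]

lemma groupInv_smul (r : R) (a : AddMonoidAlgebra R G) :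
    groupInv R G (r • a) = r • groupInv R G a := by
  ext g; simp

lemma mapRingHom_groupInv {S : Type*} [CommRing S] (f : R →+* S) (a : AddMonoidAlgebra R G) :
    mapRingHom G f (groupInv R G a) = groupInv S G (mapRingHom G f a) := by
  ext g; simp

/-- The standard inner product of two coefficient vectors is the constant coefficient of
`a * groupInv b`. -/
lemma coeff_mul_groupInv_zero [Fintype G] (a b : AddMonoidAlgebra R G) :
    (a * groupInv R G b).coeff 0 = ∑ g, a.coeff g * b.coeff g := by
  classical
  induction a using AddMonoidAlgebra.induction_linear with
  | zero => simp
  | add x y hx hy => simp [add_mul, hx, hy, Finset.sum_add_distrib]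
  | single m r => simp [coeff_single_mul_apply, Finsupp.single_apply]

lemma coeff_mul_groupInv (a b : AddMonoidAlgebra R G) (g : G) :
    (a * groupInv R G b).coeff g = (a * groupInv R G (single g 1 * b)).coeff 0 := by
  rw [map_mul, groupInv_single, mul_left_comm, coeff_single_mul_apply]
  simp

lemma smul_mul_groupInv_smul (r s : R) (a b : AddMonoidAlgebra R G) :
    (r • a) * groupInv R G (s • b) = (r * s) • (a * groupInv R G b) := by
  rw [groupInv_smul, smul_mul_smul_comm]

variable {p r : ℕ}

/-- Over a field with `q` elements, raising to the power `q ^ i` acts on the group algebra by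
multiplying the exponents by `q ^ i`. -/
lemma pow_card_pow_eq_mapDomain [Finite K] (hp : p.Prime) [CharP K p] (hK : Nat.card K = p ^ r)
    (i : ℕ) (ψ : G →+ G) (hψ : ∀ g, (p ^ r) ^ i • g = ψ g) (f : AddMonoidAlgebra K G) :
    f ^ ((p ^ r) ^ i) = mapDomainRingHom K ψ f := by
  have := Fact.mk hp
  have := Fintype.ofFinite K
  have : CharP (AddMonoidAlgebra K G) p := charP_of_injective_algebraMap
    (algebraMap K (AddMonoidAlgebra K G)).injective p
  have hq : Fintype.card K = p ^ r := by rw [← hK, Nat.card_eq_fintype_card]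
  have hq0 : (p ^ r) ^ i ≠ 0 := pow_ne_zero _ (pow_ne_zero _ hp.ne_zero)
  induction f using AddMonoidAlgebra.induction_linear with
  | zero => rw [zero_pow hq0, map_zero]
  | add x y hx hy => rw [map_add, ← hx, ← hy, ← pow_mul, add_pow_char_pow]
  | single m s =>
    have h := FiniteField.pow_card_pow i s
    rw [hq] at h
    rw [single_pow, hψ, h]
    simp

/-- If a power of the Frobenius is the inversion of `K[G]`, then the form `a * groupInv a` is
anisotropic: `a * groupInv a` is a power of `a`, and `a` is a power of itself. -/
lemma eq_zero_of_mul_groupInv_eq_zero [Finite K] (hp : p.Prime) [CharP K p]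
    (hK : Nat.card K = p ^ r) {i : ℕ} (hi : 0 < i) (h : ∀ g : G, (p ^ r) ^ i • g = -g)
    {f : AddMonoidAlgebra K G} (hf : f * groupInv K G f = 0) : f = 0 := by
  have hF : ∀ f : AddMonoidAlgebra K G, f ^ ((p ^ r) ^ i) = groupInv K G f := fun f => by
    rw [groupInv]
    exact pow_card_pow_eq_mapDomain hp hK i _ (fun g => by rw [h, coe_negAddMonoidHom]) f
  have hN : 2 ≤ (p ^ r) ^ i := by
    have h1 : 1 < p ^ r := by rw [← hK]; exact Finite.one_lt_card
    exact h1.trans_le (Nat.le_self_pow hi.ne' _)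
  generalize (p ^ r) ^ i = N at *
  have h1 : f ^ (N + 1) = 0 := by rw [pow_succ', hF, hf]
  have h2 : f ^ (N * N) = f := by rw [pow_mul, hF, hF, groupInv_groupInv]
  rw [← h2]
  exact pow_eq_zero_of_le (by nlinarith) h1

end GroupAlgebra

/-! ### Orthogonal idempotents over a finite field -/

/-- Primitive `n`-th roots of unity `ζ` and `ζ⁻¹` conjugate over a field with `q` elements are
related by a power of the Frobenius, which forces `q ^ i ≡ -1` modulo `n`. -/
lemma exists_dvd_pow_add_one_of_isConjRoot {K L : Type*} [Field K] [Finite K] [Field L]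
    [Algebra K L] [FiniteDimensional K L] {q n : ℕ} [NeZero n] (hK : Nat.card K = q) {ζ : L}
    (hζ : IsPrimitiveRoot ζ n) (hconj : IsConjRoot K ζ⁻¹ ζ) :
    ∃ i, (n : ℤ) ∣ (q : ℤ) ^ i + 1 := by
  have := Fintype.ofFinite K
  have : Finite L := Module.finite_of_finite K
  obtain ⟨σ, hσ⟩ := isConjRoot_iff_exists_algEquiv.1 hconj
  obtain ⟨i, rfl⟩ := (FiniteField.bijective_frobeniusAlgEquivOfAlgebraic_pow K L).2 σ
  refine ⟨i, ?_⟩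
  have h1 : ζ ^ q ^ (i : ℕ) = ζ⁻¹ := by
    rw [← hσ, ← hK, Nat.card_eq_fintype_card]
    simp only [AlgEquiv.coe_pow, FiniteField.coe_frobeniusAlgEquivOfAlgebraic_iterate]
  have h2 : ζ ^ (q ^ (i : ℕ) + 1) = 1 := by
    rw [pow_succ, h1, inv_mul_cancel₀ (hζ.ne_zero (NeZero.ne n))]
  exact_mod_cast (hζ.pow_eq_one_iff_dvd _).1 h2

/-- In a noetherian ring in which every element is a proper power of itself, every ideal is
idempotent and hence generated by an idempotent. -/
lemma Ideal.exists_isIdempotentElem_span_of_pow_eq {A : Type*} [CommRing A] [IsNoetherianRing A]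
    {N : ℕ} (hN : 2 ≤ N) (h : ∀ a : A, a ^ N = a) (I : Ideal A) :
    ∃ δ, IsIdempotentElem δ ∧ I = Ideal.span {δ} := by
  refine (Ideal.isIdempotentElem_iff_of_fg I (IsNoetherian.noetherian I)).1 ?_
  refine le_antisymm Ideal.mul_le_left fun a ha => ?_
  rw [← h a, ← pow_two]
  exact Ideal.pow_le_pow_right hN (Ideal.pow_mem_pow ha N)

instance AddMonoidAlgebra.finite (R M : Type*) [Semiring R] [Finite R] [Finite M] :
    Finite (AddMonoidAlgebra R M) :=
  have := Fintype.ofFinite M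
  Finite.of_equiv (M → R) (Finsupp.equivFunOnFinite.symm.trans AddMonoidAlgebra.coeffEquiv.symm)

lemma Fin.zsmul_eq_zero_of_dvd {n : ℕ} [NeZero n] {z : ℤ} (h : (n : ℤ) ∣ z) (g : Fin n) :
    z • g = 0 := by
  obtain ⟨k, rfl⟩ := h
  have : n • g = 0 := by simpa using card_nsmul_eq_zero (x := g)
  rw [mul_comm, mul_zsmul, natCast_zsmul, this, zsmul_zero]

section

variable {K : Type*} [Field K] {p r n : ℕ} [NeZero n]

/-- The algebra homomorphism `K[ℤ/n] → L` that sends the generator to an `n`-th root of unity. -/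
noncomputable def evalRoot (K : Type*) [Field K] {L : Type*} [Field L] [Algebra K L] {n : ℕ}
    [NeZero n] {ζ : L} (hζ : ζ ^ n = 1) : AddMonoidAlgebra K (Fin n) →ₐ[K] L :=
  AddMonoidAlgebra.lift K L (Fin n)
    { toFun := fun g => ζ ^ (Multiplicative.toAdd g : Fin n).val
      map_one' := by simp
      map_mul' := fun a b => by
        rw [toAdd_mul, Fin.val_add, ← pow_add, ← pow_eq_pow_mod _ hζ] }

lemma evalRoot_single {L : Type*} [Field L] [Algebra K L] {ζ : L} (hζ : ζ ^ n = 1)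
    (g : Fin n) (a : K) : evalRoot K hζ (single g a) = a • ζ ^ g.val := by
  simp [evalRoot]

/-- Inverting the group elements amounts to evaluating at `ζ⁻¹`. -/
lemma evalRoot_groupInv {L : Type*} [Field L] [Algebra K L] {ζ : L} (hζ : ζ ^ n = 1)
    (hζ' : ζ⁻¹ ^ n = 1) (f : AddMonoidAlgebra K (Fin n)) :
    evalRoot K hζ (groupInv K (Fin n) f) = evalRoot K hζ' f := by
  have h0 : ζ ≠ 0 := by
    rintro rfl
    simp [NeZero.ne n] at hζ
  induction f using AddMonoidAlgebra.induction_linear with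
  | zero => simp
  | add x y hx hy => simp [hx, hy]
  | single g a =>
    rw [groupInv_single, evalRoot_single, evalRoot_single]
    congr 1
    rw [inv_pow, ← mul_eq_one_iff_eq_inv₀ (pow_ne_zero _ h0), ← pow_add, pow_eq_pow_mod _ hζ,
      ← Fin.val_add]
    simp

/-- Let `𝔪` be the kernel of evaluation at a primitive `n`-th root of unity `ζ`. If `ζ⁻¹` is not
conjugate to `ζ`, the maximal ideals `𝔪` and `groupInv 𝔪` are comaximal; the idempotent `ε` with
`𝔪 = (1 - ε)` is then orthogonal to its image. -/
lemma exists_idempotent_mul_groupInv_eq_zero [Finite K] (hp : p.Prime) [CharP K p]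
    (hK : Nat.card K = p ^ r) (hn : n.Coprime p)
    (h : ∀ i : ℕ, ¬ (n : ℤ) ∣ ((p : ℤ) ^ r) ^ i + 1) :
    ∃ ε : AddMonoidAlgebra K (Fin n), IsIdempotentElem ε ∧ ε ≠ 0 ∧
      ε * groupInv K (Fin n) ε = 0 := by
  have hnK : NeZero (n : K) := ⟨fun h0 => by
    have := (CharP.cast_eq_zero_iff K p n).1 h0
    exact hp.one_lt.ne' (Nat.eq_one_of_dvd_coprimes hn this dvd_rfl)⟩
  let L := CyclotomicField n K
  have : FiniteDimensional K L := IsCyclotomicExtension.finiteDimensional {n} K L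
  have : Finite L := Module.finite_of_finite K
  let ζ : L := IsCyclotomicExtension.zeta n K L
  have hζ : IsPrimitiveRoot ζ n := IsCyclotomicExtension.zeta_spec n K L
  have h1 := hζ.pow_eq_one
  have h2 := hζ.inv.pow_eq_one
  let φ := evalRoot K h1
  let φ' := evalRoot K h2
  have hmax : ∀ ψ : AddMonoidAlgebra K (Fin n) →ₐ[K] L, (RingHom.ker ψ).IsMaximal := fun ψ =>
    Ideal.IsPrime.isMaximal' (RingHom.ker_isPrime ψ)
  have hne : RingHom.ker φ ≠ RingHom.ker φ' := by
    intro heq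
    let X : AddMonoidAlgebra K (Fin n) := single (Fin.ofNat n 1) 1
    have hX : ∀ {ξ : L} (hξ : ξ ^ n = 1), evalRoot K hξ X = ξ := fun {ξ} hξ => by
      simp only [X, evalRoot_single, Fin.val_ofNat, ← pow_eq_pow_mod _ hξ, one_smul, pow_one]
    have h3 : Polynomial.aeval X (minpoly K ζ) ∈ RingHom.ker φ := by
      rw [RingHom.mem_ker, ← Polynomial.aeval_algHom_apply, hX, minpoly.aeval]
    rw [heq, RingHom.mem_ker, ← Polynomial.aeval_algHom_apply, hX] at h3
    have hconj : IsConjRoot K ζ ζ⁻¹ :=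
      (isConjRoot_iff_aeval_eq_zero (Algebra.IsIntegral.isIntegral ζ)).2 h3
    obtain ⟨i, hi⟩ := exists_dvd_pow_add_one_of_isConjRoot hK hζ hconj.symm
    exact h i (by exact_mod_cast hi)
  have hpow : ∃ N, 2 ≤ N ∧ ∀ f : AddMonoidAlgebra K (Fin n), f ^ N = f := by
    -- `q` is invertible modulo `n`, so some `q ^ t` with `0 < t` is `1` modulo `n`.
    refine ⟨(p ^ r) ^ n.totient, ?_, fun f => ?_⟩
    · have h1 : 1 < p ^ r := by rw [← hK]; exact Finite.one_lt_card
      exact h1.trans_le (Nat.le_self_pow (Nat.totient_pos.2 (NeZero.pos n)).ne' _)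
    · rw [pow_card_pow_eq_mapDomain hp hK _ (AddMonoidHom.id _), mapDomainRingHom_id]
      · rfl
      · intro g
        have h3 := (Nat.modEq_iff_dvd.1 (Nat.ModEq.pow_totient (hn.symm.pow_left r)).symm)
        have h4 := Fin.zsmul_eq_zero_of_dvd h3 g
        rwa [sub_zsmul, natCast_zsmul, natCast_zsmul, one_nsmul, add_neg_eq_zero] at h4
  obtain ⟨N, hN, hpow⟩ := hpow
  obtain ⟨δ, hδ, hspan⟩ := (RingHom.ker φ).exists_isIdempotentElem_span_of_pow_eq hN hpow
  have hcop : RingHom.ker φ ⊔ RingHom.ker φ' = ⊤ :=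
    Ideal.IsMaximal.coprime_of_ne (hmax φ) (hmax φ') hne
  have hker : ∀ f, φ f = 0 → (1 - δ) * f = 0 := by
    intro f hf
    have : f ∈ Ideal.span {δ} := hspan ▸ hf
    obtain ⟨g, rfl⟩ := Ideal.mem_span_singleton.1 this
    rw [← mul_assoc, sub_mul, one_mul, hδ.eq, sub_self, zero_mul]
  refine ⟨1 - δ, hδ.one_sub, ?_, ?_⟩
  · intro h0
    refine (hmax φ).ne_top ?_
    rw [hspan, ← sub_eq_zero.1 h0, Ideal.span_singleton_one]
  · obtain ⟨f, hf, g, hg, hfg⟩ := Submodule.mem_sup.1 ((Ideal.eq_top_iff_one _).1 hcop)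
    have hf' := hker f hf
    have hg' := congrArg (groupInv K (Fin n)) (hker (groupInv K (Fin n) g)
      ((evalRoot_groupInv h1 h2 g).trans hg))
    rw [map_mul, groupInv_groupInv, map_zero] at hg'
    calc _ = groupInv K (Fin n) (1 - δ) * ((1 - δ) * f) +
          (1 - δ) * (groupInv K (Fin n) (1 - δ) * g) := by
          rw [← mul_one ((1 - δ) * _), ← hfg]; ring
      _ = 0 := by rw [hf', hg', mul_zero, mul_zero, add_zero]

end

/-! ### Annihilators of powers in a finite chain ring -/

namespace IsFiniteChainRing

variable {R : Type*} [CommRing R] {γ : R}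

lemma eq_span_of_isMaximal (hR : IsFiniteChainRing R) (hγ : (Ideal.span {γ}).IsMaximal)
    {M : Ideal R} (hM : M.IsMaximal) : M = Ideal.span {γ} := by
  rcases hR.ideal_total M (Ideal.span {γ}) with h | h
  · exact hM.eq_of_le hγ.ne_top h
  · exact (hγ.eq_of_le hM.ne_top h).symm

lemma dvd_of_not_isUnit (hR : IsFiniteChainRing R) (hγ : (Ideal.span {γ}).IsMaximal) {a : R}
    (ha : ¬ IsUnit a) : γ ∣ a := by
  obtain ⟨M, hM, haM⟩ := exists_max_ideal_of_mem_nonunits ha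
  rw [hR.eq_span_of_isMaximal hγ hM] at haM
  exact Ideal.mem_span_singleton.1 haM

lemma isNilpotent_generator (hR : IsFiniteChainRing R) (hγ : (Ideal.span {γ}).IsMaximal) :
    IsNilpotent γ := by
  have := hR.finite
  refine nilpotent_iff_mem_prime.2 fun J hJ => ?_
  rw [hR.eq_span_of_isMaximal hγ (Ideal.IsPrime.isMaximal' hJ)]
  exact Ideal.mem_span_singleton_self γ

/-- The annihilator of `γ ^ i` is generated by `γ ^ (e - i)`. -/
lemma pow_dvd_of_pow_mul_eq_zero (hR : IsFiniteChainRing R) (hγ : (Ideal.span {γ}).IsMaximal)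
    {i j : ℕ} (hij : i + j ≤ nilpotencyClass γ) {a : R} (ha : γ ^ i * a = 0) : γ ^ j ∣ a := by
  induction j with
  | zero => simp
  | succ j ih =>
    obtain ⟨b, rfl⟩ := ih (by lia)
    rw [pow_succ]
    refine mul_dvd_mul_left _ (hR.dvd_of_not_isUnit hγ fun hb => ?_)
    rw [← mul_assoc, ← pow_add, hb.mul_left_eq_zero] at ha
    have : nilpotencyClass γ ≤ i + j := Nat.sInf_le ha
    lia

end IsFiniteChainRing

/-! ### Reduction of the group algebra modulo `γ` -/

section Reduction

variable {R G : Type*} [CommRing R] [AddCommGroup G] {γ : R}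

lemma exists_eq_smul_of_coeff_dvd {d : R} {a : AddMonoidAlgebra R G}
    (h : ∀ g, d ∣ a.coeff g) : ∃ b : AddMonoidAlgebra R G, a = d • b := by
  classical
  choose f hf using h
  refine ⟨∑ g ∈ a.coeff.support, single g (f g), ?_⟩
  ext g
  by_cases hg : a.coeff g = 0
  · simp [Finsupp.single_apply, hg]
  · simp [Finsupp.single_apply, hg, ← hf]

lemma IsFiniteChainRing.exists_eq_pow_smul (hR : IsFiniteChainRing R)
    (hγ : (Ideal.span {γ}).IsMaximal) {i j : ℕ} (hij : i + j ≤ nilpotencyClass γ)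
    {a : AddMonoidAlgebra R G} (ha : γ ^ i • a = 0) :
    ∃ b : AddMonoidAlgebra R G, a = γ ^ j • b := by
  refine exists_eq_smul_of_coeff_dvd fun g => hR.pow_dvd_of_pow_mul_eq_zero hγ hij ?_
  simpa using congrArg (fun x => x.coeff g) ha

/-- Reduction of the coefficients modulo `γ`. -/
noncomputable def reduceMod (γ : R) (G : Type*) [AddCommGroup G] :
    AddMonoidAlgebra R G →+* AddMonoidAlgebra (R ⧸ Ideal.span {γ}) G :=
  mapRingHom G (Ideal.Quotient.mk (Ideal.span {γ}))

lemma reduceMod_groupInv (a : AddMonoidAlgebra R G) :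
    reduceMod γ G (groupInv R G a) = groupInv _ G (reduceMod γ G a) :=
  mapRingHom_groupInv _ a

lemma reduceMod_smul_self (a : AddMonoidAlgebra R G) : reduceMod γ G (γ • a) = 0 := by
  ext g
  simp [reduceMod]

lemma exists_eq_smul_of_reduceMod_eq_zero {a : AddMonoidAlgebra R G}
    (ha : reduceMod γ G a = 0) : ∃ b : AddMonoidAlgebra R G, a = γ • b := by
  refine exists_eq_smul_of_coeff_dvd fun g => ?_
  have := congrArg (fun x => x.coeff g) ha
  simpa [reduceMod, Ideal.Quotient.eq_zero_iff_mem, Ideal.mem_span_singleton] using this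

lemma isNilpotent_of_reduceMod_eq_zero (hγ : IsNilpotent γ) {a : AddMonoidAlgebra R G}
    (ha : reduceMod γ G a = 0) : IsNilpotent a := by
  obtain ⟨b, rfl⟩ := exists_eq_smul_of_reduceMod_eq_zero ha
  obtain ⟨m, hm⟩ := hγ
  exact ⟨m, by rw [smul_pow, hm, zero_smul]⟩

lemma reduceMod_surjective : Function.Surjective (reduceMod γ G) := by
  intro f
  induction f using AddMonoidAlgebra.induction_linear with
  | zero => exact ⟨0, map_zero _⟩
  | add x y hx hy =>
    obtain ⟨a, rfl⟩ := hx
    obtain ⟨b, rfl⟩ := hy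
    exact ⟨a + b, map_add _ _ _⟩
  | single g s =>
    obtain ⟨s, rfl⟩ := Ideal.Quotient.mk_surjective s
    exact ⟨single g s, by simp [reduceMod]⟩

/-- Lifting along the reduction preserves orthogonality of an idempotent `ε` with its image under
the involution, because the product of the lifts is an idempotent and nilpotent. -/
lemma exists_idempotent_lift (hγ : IsNilpotent γ)
    {ε : AddMonoidAlgebra (R ⧸ Ideal.span {γ}) G} (hε : IsIdempotentElem ε)
    (h : ε * groupInv _ G ε = 0) :
    ∃ E : AddMonoidAlgebra R G, IsIdempotentElem E ∧ E * groupInv R G E = 0 ∧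
      reduceMod γ G E = ε := by
  obtain ⟨E, hE, rfl⟩ := exists_isIdempotentElem_eq_of_ker_isNilpotent (reduceMod γ G)
    (fun x hx => isNilpotent_of_reduceMod_eq_zero hγ hx) ε (reduceMod_surjective ε) hε
  refine ⟨E, hE, ?_, rfl⟩
  have h1 : IsIdempotentElem (E * groupInv R G E) := hE.mul (hE.map (groupInv R G))
  have h2 : IsNilpotent (E * groupInv R G E) := isNilpotent_of_reduceMod_eq_zero hγ (by
    rw [map_mul, reduceMod_groupInv, h])
  obtain ⟨m, hm⟩ := h2
  rw [← h1.pow_succ_eq m, pow_succ, hm, zero_mul]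

end Reduction

/-! ### Cyclic codes as ideals of the group algebra -/

lemma Fin.val_nsmul_one {n : ℕ} [NeZero n] (k : ℕ) : (k • (1 : Fin n)).val = k % n := by
  induction k with
  | zero => simp
  | succ k ih => rw [succ_nsmul, Fin.val_add, ih, Fin.val_one', ← Nat.add_mod]

namespace LinearCode

variable {R : Type*} [CommRing R] {n : ℕ}

/-- Vectors of length `n` as elements of the group algebra of `ℤ/n`. -/
noncomputable def toGroupAlgebra (R : Type*) [CommRing R] (n : ℕ) :
    (Fin n → R) ≃ₗ[R] AddMonoidAlgebra R (Fin n) where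
  toFun c := .ofCoeff (Finsupp.equivFunOnFinite.symm c)
  invFun a := a.coeff
  map_add' c d := by ext; simp
  map_smul' s c := by ext; simp
  left_inv c := by ext; simp
  right_inv a := by ext; simp

@[simp] lemma coeff_toGroupAlgebra (c : Fin n → R) (i : Fin n) :
    (toGroupAlgebra R n c).coeff i = c i := rfl

lemma mem_trivialCode {γ : R} {e : ℕ} {c : Fin n → R} :
    c ∈ trivialCode γ e n ↔ ∃ b : Fin n → R, c = γ ^ (e / 2) • b := by
  have hrow : ∀ i, (γ ^ (e / 2) • (1 : Matrix (Fin n) (Fin n) R)).row i =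
      γ ^ (e / 2) • Pi.single i 1 := by
    intro i
    ext j
    simp [Matrix.row, Matrix.one_apply, Pi.single_apply, eq_comm]
  constructor
  · intro h
    have hle : trivialCode γ e n ≤ LinearMap.range
        (LinearMap.lsmul R (Fin n → R) (γ ^ (e / 2))) := by
      refine Submodule.span_le.2 ?_
      rintro _ ⟨i, rfl⟩
      exact ⟨Pi.single i 1, (hrow i).symm⟩
    obtain ⟨b, hb⟩ := hle h
    exact ⟨b, hb.symm⟩
  · rintro ⟨b, rfl⟩
    rw [pi_eq_sum_univ' b, Finset.smul_sum]
    refine Submodule.sum_mem _ fun i _ => ?_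
    rw [smul_comm]
    exact Submodule.smul_mem _ _ (Submodule.subset_span ⟨i, hrow i⟩)

variable [NeZero n]

lemma toGroupAlgebra_rotate (c : Fin n → R) :
    toGroupAlgebra R n (fun i => c ((finRotate n).symm i)) =
      single 1 1 * toGroupAlgebra R n c := by
  ext i
  rw [coeff_single_mul_apply, one_mul, coeff_toGroupAlgebra, coeff_toGroupAlgebra,
    finRotate_symm_apply, neg_add_eq_sub]

/-- Under the identification with the group algebra of `ℤ/n`, a cyclic code is stable under
multiplication by all group elements. -/
lemma IsCyclic.exists_single_mul {C : Submodule R (Fin n → R)} (hC : IsCyclic C) (g : Fin n)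
    {c : Fin n → R} (hc : c ∈ C) :
    ∃ d ∈ C, toGroupAlgebra R n d = single g 1 * toGroupAlgebra R n c := by
  have key : ∀ k : ℕ, ∃ d ∈ C,
      toGroupAlgebra R n d = single (k • 1) 1 * toGroupAlgebra R n c := by
    intro k
    induction k with
    | zero => exact ⟨c, hc, by simp [← one_def]⟩
    | succ k ih =>
      obtain ⟨d, hd, h⟩ := ih
      refine ⟨_, hC d hd, ?_⟩
      rw [toGroupAlgebra_rotate, h, ← mul_assoc, single_mul_single, one_mul, succ_nsmul']
  have hg : g.val • (1 : Fin n) = g := Fin.ext (by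
    rw [Fin.val_nsmul_one, Nat.mod_eq_of_lt g.isLt])
  rw [← hg]
  exact key g.val

/-- For a cyclic code, orthogonality to all codewords is the vanishing of whole products in the
group algebra, not only of their constant coefficients. -/
lemma IsCyclic.mem_dual_iff {C : Submodule R (Fin n → R)} (hC : IsCyclic C) {u : Fin n → R} :
    u ∈ dual C ↔ ∀ v ∈ C,
      toGroupAlgebra R n u * groupInv R (Fin n) (toGroupAlgebra R n v) = 0 := by
  constructor
  · intro hu v hv
    ext g
    obtain ⟨w, hw, h⟩ := hC.exists_single_mul g hv
    rw [coeff_mul_groupInv, ← h, coeff_mul_groupInv_zero]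
    exact hu w hw
  · intro h v hv
    have := congrArg (fun x => x.coeff 0) (h v hv)
    simpa [coeff_mul_groupInv_zero] using this

end LinearCode

/-! ### Self-dual cyclic codes -/

section SelfDual

variable {R : Type*} [CommRing R] {γ : R} {p r n : ℕ}

lemma charP_residueField (hγ : (Ideal.span {γ}).IsMaximal) (hp : p.Prime)
    (hK : Nat.card (R ⧸ Ideal.span {γ}) = p ^ r) :
    CharP (R ⧸ Ideal.span {γ}) p := by
  let := Ideal.Quotient.field (Ideal.span {γ})
  have : Finite (R ⧸ Ideal.span {γ}) :=
    Nat.finite_of_card_ne_zero (hK ▸ pow_ne_zero _ hp.ne_zero)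
  have := Fintype.ofFinite (R ⧸ Ideal.span {γ})
  have := Fact.mk hp
  exact charP_of_card_eq_prime_pow (f := r) (by rw [← Nat.card_eq_fintype_card, hK])

/-- A codeword `a` satisfies `a * groupInv a = 0`. Once `γ ^ j` with `2 * j < e` is cancelled from
`a`, the cofactor has the same property modulo `γ`, so anisotropy over the residue field yields
one more factor `γ`. -/
lemma IsFiniteChainRing.selfDual_eq_trivialCode (hR : IsFiniteChainRing R)
    (hγ : (Ideal.span {γ}).IsMaximal) (heven : Even (nilpotencyClass γ)) (hp : p.Prime)
    (hK : Nat.card (R ⧸ Ideal.span {γ}) = p ^ r) [NeZero n] {i : ℕ} (hi : 0 < i)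
    (h : (n : ℤ) ∣ ((p : ℤ) ^ r) ^ i + 1) {C : Submodule R (Fin n → R)}
    (hC : LinearCode.IsCyclic C) (hsd : LinearCode.IsSelfDual C) :
    C = LinearCode.trivialCode γ (nilpotencyClass γ) n := by
  let := Ideal.Quotient.field (Ideal.span {γ})
  have := charP_residueField hγ hp hK
  have : Finite (R ⧸ Ideal.span {γ}) :=
    Nat.finite_of_card_ne_zero (by rw [hK]; exact pow_ne_zero _ hp.ne_zero)
  have hneg : ∀ g : Fin n, (p ^ r) ^ i • g = -g := by
    intro g
    have h1 := Fin.zsmul_eq_zero_of_dvd h g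
    rw [add_zsmul, one_zsmul, add_eq_zero_iff_eq_neg] at h1
    rw [← h1, ← natCast_zsmul]
    push_cast
    rfl
  have hhalf : 2 * (nilpotencyClass γ / 2) = nilpotencyClass γ := Nat.two_mul_div_two_of_even heven
  have hle : C ≤ LinearCode.trivialCode γ (nilpotencyClass γ) n := by
    intro c hc
    have hc0 : LinearCode.toGroupAlgebra R n c *
        groupInv R (Fin n) (LinearCode.toGroupAlgebra R n c) = 0 := by
      have : c ∈ LinearCode.dual C := hsd ▸ hc
      exact hC.mem_dual_iff.1 this c hc
    have key : ∀ j ≤ nilpotencyClass γ / 2, ∃ b, LinearCode.toGroupAlgebra R n c = γ ^ j • b := by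
      intro j hj
      induction j with
      | zero => exact ⟨_, by rw [pow_zero, one_smul]⟩
      | succ j ih =>
        obtain ⟨b, hb⟩ := ih (by lia)
        rw [hb, smul_mul_groupInv_smul, ← pow_add] at hc0
        obtain ⟨d, hd⟩ := hR.exists_eq_pow_smul hγ (j := 1) (by lia) hc0
        have h2 : reduceMod γ (Fin n) b * groupInv _ (Fin n) (reduceMod γ (Fin n) b) = 0 := by
          rw [← reduceMod_groupInv, ← map_mul, hd, pow_one, reduceMod_smul_self]
        obtain ⟨b', rfl⟩ := exists_eq_smul_of_reduceMod_eq_zero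
          (eq_zero_of_mul_groupInv_eq_zero hp hK hi hneg h2)
        exact ⟨b', by rw [hb, smul_smul, pow_succ]⟩
    obtain ⟨b, hb⟩ := key _ le_rfl
    refine LinearCode.mem_trivialCode.2 ⟨(LinearCode.toGroupAlgebra R n).symm b, ?_⟩
    rw [← map_smul, ← hb, LinearEquiv.symm_apply_apply]
  refine le_antisymm hle fun c hc => ?_
  rw [hsd]
  intro v hv
  obtain ⟨a, rfl⟩ := LinearCode.mem_trivialCode.1 hc
  obtain ⟨b, rfl⟩ := LinearCode.mem_trivialCode.1 (hle hv)
  have h0 : γ ^ (nilpotencyClass γ / 2) * γ ^ (nilpotencyClass γ / 2) = 0 := by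
    rw [← pow_add, ← two_mul, hhalf, pow_nilpotencyClass (hR.isNilpotent_generator hγ)]
  refine Finset.sum_eq_zero fun x _ => ?_
  rw [Pi.smul_apply, Pi.smul_apply, smul_mul_smul_comm, h0, zero_smul]

/-- The submodule of vectors whose component along an element `P` of the group algebra is
annihilated by the scalar `s`. -/
noncomputable def annihilatedComponent [NeZero n] (s : R) (P : AddMonoidAlgebra R (Fin n)) :
    Submodule R (Fin n → R) :=
  LinearMap.ker (s • LinearMap.mulRight R P ∘ₗ (LinearCode.toGroupAlgebra R n).toLinearMap)

lemma mem_annihilatedComponent [NeZero n] {s : R} {P : AddMonoidAlgebra R (Fin n)}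
    {c : Fin n → R} :
    c ∈ annihilatedComponent s P ↔ s • (LinearCode.toGroupAlgebra R n c * P) = 0 := by
  simp [annihilatedComponent]

lemma isCyclic_annihilatedComponent [NeZero n] (s : R) (P : AddMonoidAlgebra R (Fin n)) :
    LinearCode.IsCyclic (annihilatedComponent s P) := by
  intro c hc
  rw [mem_annihilatedComponent] at hc ⊢
  rw [LinearCode.toGroupAlgebra_rotate, mul_assoc, ← mul_smul_comm, hc, mul_zero]

lemma LinearCode.IsCyclic.inf {C D : Submodule R (Fin n → R)} (hC : IsCyclic C)
    (hD : IsCyclic D) : IsCyclic (C ⊓ D) :=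
  fun c hc => ⟨hC c hc.1, hD c hc.2⟩

/-- On the component cut out by an idempotent `P`, being killed by `γ ^ i` means being divisible by
`γ ^ j`, so elements killed by complementary powers of `γ` have product zero there. -/
lemma IsFiniteChainRing.mul_mul_idempotent_eq_zero {G : Type*} [AddCommGroup G]
    (hR : IsFiniteChainRing R) (hγ : (Ideal.span {γ}).IsMaximal) {i j : ℕ}
    (hij : i + j = nilpotencyClass γ) {P a b : AddMonoidAlgebra R G} (hP : IsIdempotentElem P)
    (ha : γ ^ i • (a * P) = 0) (hb : γ ^ j • (b * P) = 0) : a * b * P = 0 := by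
  obtain ⟨x, hx⟩ := hR.exists_eq_pow_smul hγ hij.le ha
  calc a * b * P = a * P * (b * P) := by rw [mul_mul_mul_comm, hP.eq]
    _ = 0 := by rw [hx, smul_mul_assoc, ← mul_smul_comm, hb, mul_zero]

/-- From an idempotent `E` with `E * groupInv E = 0`, and `e = 2 * (m + 1)`, one obtains the cyclic
self-dual code `γ ^ m E + γ ^ (m + 2) (groupInv E) + γ ^ (m + 1) (1 - E - groupInv E)`: the
involution exchanges the first two components and fixes the third. -/
lemma IsFiniteChainRing.exists_selfDual_ne_trivialCode (hR : IsFiniteChainRing R)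
    (hγ : (Ideal.span {γ}).IsMaximal) (heven : Even (nilpotencyClass γ)) [NeZero n]
    {E : AddMonoidAlgebra R (Fin n)} (hE : IsIdempotentElem E)
    (hE' : E * groupInv R (Fin n) E = 0) (hne : reduceMod γ (Fin n) E ≠ 0) :
    ∃ C : Submodule R (Fin n → R), LinearCode.IsCyclic C ∧ LinearCode.IsSelfDual C ∧
      C ≠ LinearCode.trivialCode γ (nilpotencyClass γ) n := by
  have hnil := hR.isNilpotent_generator hγ
  obtain ⟨m, hm⟩ : ∃ m, nilpotencyClass γ = 2 * (m + 1) := by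
    have := hR.nontrivial
    have hpos : 0 < nilpotencyClass γ := pos_nilpotencyClass_iff.2 hnil
    obtain ⟨k, hk⟩ := heven
    exact ⟨k - 1, by lia⟩
  have hzero : ∀ {i : ℕ}, nilpotencyClass γ ≤ i → γ ^ i = 0 := fun hi =>
    pow_eq_zero_of_le hi (pow_nilpotencyClass hnil)
  set F := groupInv R (Fin n) E with hF
  have hFE : groupInv R (Fin n) F = E := groupInv_groupInv E
  have hFF : IsIdempotentElem F := hE.map (groupInv R (Fin n))
  have hE2 : E * E = E := hE
  have hF2 : F * F = F := hFF
  obtain ⟨H, hH⟩ : ∃ H, H = 1 - E - F := ⟨_, rfl⟩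
  have hHinv : groupInv R (Fin n) H = H := by
    rw [hH, map_sub, map_sub, map_one, hFE, ← hF]; ring
  have hEH : E * H = 0 := by rw [hH]; linear_combination -hE2 - hE'
  have hFH : F * H = 0 := by rw [hH]; linear_combination -hF2 - hE'
  have hHH : IsIdempotentElem H := by
    change H * H = H
    nth_rw 1 [hH]; linear_combination -hEH - hFH
  have hsum : E + F + H = 1 := by rw [hH]; ring
  let C : Submodule R (Fin n → R) := annihilatedComponent (γ ^ (m + 2)) E ⊓
    annihilatedComponent (γ ^ m) F ⊓ annihilatedComponent (γ ^ (m + 1)) H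
  have hmem : ∀ c, c ∈ C ↔ (γ ^ (m + 2) • (LinearCode.toGroupAlgebra R n c * E) = 0 ∧
      γ ^ m • (LinearCode.toGroupAlgebra R n c * F) = 0) ∧
      γ ^ (m + 1) • (LinearCode.toGroupAlgebra R n c * H) = 0 := by
    intro c
    simp only [C, Submodule.mem_inf, mem_annihilatedComponent]
  have hC : LinearCode.IsCyclic C :=
    ((isCyclic_annihilatedComponent _ _).inf (isCyclic_annihilatedComponent _ _)).inf
      (isCyclic_annihilatedComponent _ _)
  have hinv : ∀ (s : R) (b P : AddMonoidAlgebra R (Fin n)), s • (b * P) = 0 →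
      s • (groupInv R (Fin n) b * groupInv R (Fin n) P) = 0 := by
    intro s b P h
    rw [← map_mul, ← groupInv_smul, h, map_zero]
  have hgenE : (LinearCode.toGroupAlgebra R n).symm (γ ^ m • E) ∈ C := by
    rw [hmem, LinearEquiv.apply_symm_apply]
    simp only [smul_mul_assoc, hE2, hE', hEH, smul_zero, smul_smul, ← pow_add]
    simp [hzero (show nilpotencyClass γ ≤ m + 2 + m by lia)]
  have hgenF : (LinearCode.toGroupAlgebra R n).symm (γ ^ (m + 2) • F) ∈ C := by
    rw [hmem, LinearEquiv.apply_symm_apply]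
    simp only [smul_mul_assoc, hF2, mul_comm F E, hE', hFH, smul_zero, smul_smul, ← pow_add]
    simp [hzero (show nilpotencyClass γ ≤ m + (m + 2) by lia)]
  have hgenH : (LinearCode.toGroupAlgebra R n).symm (γ ^ (m + 1) • H) ∈ C := by
    rw [hmem, LinearEquiv.apply_symm_apply]
    simp only [smul_mul_assoc, hHH.eq, mul_comm H E, mul_comm H F, hEH, hFH, smul_zero, smul_smul,
      ← pow_add]
    simp [hzero (show nilpotencyClass γ ≤ m + 1 + (m + 1) by lia)]
  refine ⟨C, hC, le_antisymm ?_ ?_, ?_⟩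
  · intro u hu
    rw [hC.mem_dual_iff]
    intro v hv
    obtain ⟨⟨u1, u2⟩, u3⟩ := (hmem u).1 hu
    obtain ⟨⟨v1, v2⟩, v3⟩ := (hmem v).1 hv
    have v1 := hinv _ _ _ v1
    have v2 := hinv _ _ _ v2
    have v3 := hinv _ _ _ v3
    rw [hFE] at v2
    rw [← hF] at v1
    rw [hHinv] at v3
    rw [← mul_one (_ * _), ← hsum, mul_add, mul_add,
      hR.mul_mul_idempotent_eq_zero hγ (by lia) hE u1 v2,
      hR.mul_mul_idempotent_eq_zero hγ (by lia) hFF u2 v1,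
      hR.mul_mul_idempotent_eq_zero hγ (by lia) hHH u3 v3, add_zero, add_zero]
  · intro u hu
    rw [hC.mem_dual_iff] at hu
    have h1 := hu _ hgenE
    have h2 := hu _ hgenF
    have h3 := hu _ hgenH
    rw [LinearEquiv.apply_symm_apply, groupInv_smul, mul_smul_comm] at h1 h2 h3
    rw [hFE] at h2
    rw [hHinv] at h3
    exact (hmem u).2 ⟨⟨h2, h1⟩, h3⟩
  · intro heq
    rw [heq] at hgenE
    obtain ⟨b, hb⟩ := LinearCode.mem_trivialCode.1 hgenE
    rw [LinearEquiv.symm_apply_eq, map_smul] at hb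
    have h1 : γ ^ (2 * m + 1) • E = 0 := by
      rw [show 2 * m + 1 = (m + 1) + m by lia, pow_add, mul_smul, hb, smul_smul, ← pow_add,
        hzero (by lia), zero_smul]
    obtain ⟨d, hd⟩ := hR.exists_eq_pow_smul hγ (j := 1) (by lia) h1
    rw [hd, pow_one, reduceMod_smul_self] at hne
    exact hne rfl

end SelfDual

/-! ### Powers of `q` modulo `n` and the coset of `1` -/

lemma exists_pos_dvd_pow_add_one {q n i : ℕ} (hq : q.Coprime n) (hn : n ≠ 0)
    (h : (n : ℤ) ∣ (q : ℤ) ^ i + 1) : ∃ j, 0 < j ∧ (n : ℤ) ∣ (q : ℤ) ^ j + 1 := by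
  refine ⟨i + n.totient, Nat.add_pos_right _ (Nat.totient_pos.2 (Nat.pos_of_ne_zero hn)), ?_⟩
  have h1 : (n : ℤ) ∣ (q : ℤ) ^ n.totient - 1 := by
    exact_mod_cast Nat.modEq_iff_dvd.1 (Nat.ModEq.pow_totient hq).symm
  have h2 : (q : ℤ) ^ (i + n.totient) + 1 =
      (q : ℤ) ^ i * ((q : ℤ) ^ n.totient - 1) + ((q : ℤ) ^ i + 1) := by ring
  rw [h2]
  exact dvd_add (h1.mul_left _) h

lemma isReversibleCoset_one_iff {q n : ℕ} :
    IsReversibleCoset q n 1 ↔ ∃ i, (n : ℤ) ∣ (q : ℤ) ^ i + 1 := by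
  have hdvd : ∀ i, (n : ℤ) ∣ (q : ℤ) ^ i + 1 ↔ (-1 : ZMod n) = (q : ZMod n) ^ i := by
    intro i
    rw [← ZMod.intCast_zmod_eq_zero_iff_dvd]
    push_cast
    rw [add_eq_zero_iff_eq_neg, eq_comm]
  simp only [hdvd, IsReversibleCoset, cyclotomicCoset, Set.ext_iff, Set.mem_ofPred_eq, one_mul]
  constructor
  · intro h
    exact (h (-1)).2 ⟨0, by simp⟩
  · rintro ⟨i, hi⟩ x
    constructor
    · rintro ⟨j, rfl⟩
      exact ⟨i + j, by rw [pow_add, ← hi, ← mul_assoc, neg_mul_neg, one_mul, one_mul]⟩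
    · rintro ⟨j, rfl⟩
      exact ⟨i + j, by rw [pow_add, ← hi]⟩

/-! ### Existence of nontrivial self-dual cyclic codes -/

theorem mainTheorem4 {R : Type*} [CommRing R] (hR : IsFiniteChainRing R)
    (γ : R) (hγ : (Ideal.span {γ}).IsMaximal)
    (e : ℕ) (he : nilpotencyClass γ = e) (heven : Even e)
    (p r : ℕ) (hp : p.Prime) (hK : Nat.card (R ⧸ Ideal.span {γ}) = p ^ r)
    (n : ℕ) (hn : n.Coprime p) :
    ((∃ C : Submodule R (Fin n → R),
        LinearCode.IsCyclic C ∧ LinearCode.IsSelfDual C ∧ C ≠ LinearCode.trivialCode γ e n) ↔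
      ∀ i : ℕ, 0 < i → ¬ ((p : ℤ) ^ r) ^ i ≡ -1 [ZMOD (n : ℤ)]) ∧
    ((∀ i : ℕ, 0 < i → ¬ ((p : ℤ) ^ r) ^ i ≡ -1 [ZMOD (n : ℤ)]) ↔
      ¬ IsReversibleCoset (p ^ r) n (1 : ZMod n)) := by
  subst he
  -- `n = 0` is excluded because `p` is not a unit.
  have hn0 : n ≠ 0 := by
    rintro rfl
    exact hp.one_lt.ne' ((Nat.coprime_zero_left p).1 hn)
  have := NeZero.mk hn0
  have hmod : ∀ i : ℕ, ((p : ℤ) ^ r) ^ i ≡ -1 [ZMOD (n : ℤ)] ↔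
      (n : ℤ) ∣ ((p : ℤ) ^ r) ^ i + 1 := by
    intro i
    rw [Int.modEq_comm, Int.modEq_iff_dvd, sub_neg_eq_add]
  have hpos : (∀ i : ℕ, 0 < i → ¬ ((p : ℤ) ^ r) ^ i ≡ -1 [ZMOD (n : ℤ)]) ↔
      ∀ i : ℕ, ¬ (n : ℤ) ∣ ((p : ℤ) ^ r) ^ i + 1 := by
    simp only [hmod]
    refine ⟨fun h i hi => ?_, fun h i _ => h i⟩
    obtain ⟨j, hj, hj'⟩ := exists_pos_dvd_pow_add_one (q := p ^ r) (hn.symm.pow_left r) hn0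
      (by exact_mod_cast hi)
    exact h j hj (by exact_mod_cast hj')
  refine ⟨⟨?_, ?_⟩, ?_⟩
  · rintro ⟨C, hC, hsd, hne⟩ i hi h
    exact hne (hR.selfDual_eq_trivialCode hγ heven hp hK hi ((hmod i).1 h) hC hsd)
  · intro h
    let := Ideal.Quotient.field (Ideal.span {γ})
    have := charP_residueField hγ hp hK
    have : Finite (R ⧸ Ideal.span {γ}) :=
      Nat.finite_of_card_ne_zero (by rw [hK]; exact pow_ne_zero _ hp.ne_zero)
    obtain ⟨ε, hε, hε0, horth⟩ := exists_idempotent_mul_groupInv_eq_zero hp hK hn (hpos.1 h)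
    obtain ⟨E, hE, hE', rfl⟩ :=
      exists_idempotent_lift (hR.isNilpotent_generator hγ) hε horth
    exact hR.exists_selfDual_ne_trivialCode hγ heven hE hE' hε0
  · rw [hpos, isReversibleCoset_one_iff, not_exists]
    push_cast
    rfl
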